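/- Let $r\ge 2$. Let $E_r=\{a\in\mathbb R^{r+1}: a_1+\cdots+a_{r+1}=0\}$, with coordinates $(a_1,\dots,a_r)$ and the measure $da=da_1\cdots da_r$, and let $A_r^+=\{e^i-e^j : 1\le i<j\le r+1\}\subset E_r$, where $e^1,\dots,e^{r+1}$ is the standard basis of $\mathbb R^{r+1}$. For a finite sequence $\Phi=(\alpha^1,\dots,\alpha^N)$ of elements of $A_r^+$ spanning $E_r$ and $a\in E_r$, let $P_\Phi(a)=\{u\in\mathbb R_{\ge 0}^N : \sum_k u_k\alpha^k=a\}$, and let $\operatorname{vol}P_\Phi(a)$ be its volume for the Lebesgue measure on the fibres of $p:\mathbb R^N\to E_r$, $u\mapsto\sum_k u_k\alpha^k$, that is the quotient of the Lebesgue measure $du$ of $\mathbb R^N$ by $da$. Let $\mathfrak c^+=\{a\in C(A_r^+): a_1>0,\dots,a_r>0\}$ be the nice chamber, where $C(A_r^+)$ is the convex cone generated by $A_r^+$, and let $v(\Phi,\mathfrak c^+)$ be the (unique) polynomial in $a_1,\dots,a_r$ with $v(\Phi,\mathfrak c^+)(a_1,\dots,a_r)=\operatorname{vol}P_\Phi(a)$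 for all $a\in\overline{\mathfrak c^+}$. The polynomials $v_r^+=v(A_r^+,\mathfrak c^+)$ and $v(A_r^+\setminus\{e^{r-1}-e^r\},\mathfrak c^+)$ exist, and $v_r^+$ is independent of $a_r$, is homogeneous of degree $r(r-1)/2$, has degree at most $1$ in $a_{r-1}$ and, if $r\ge 3$, is divisible by $a_1^{r-1}(a_1+a_2+\cdots+a_{r-2}+3a_{r-1})$. More precisely, $$3\,v_r^+(a_1,\dots,a_r)=(a_1+a_2+\cdots+a_{r-2}+3a_{r-1})\; v\bigl(A_r^+\setminus\{e^{r-1}-e^r\},\mathfrak c^+\bigr)(a_1,\dots,a_{r-2},0,0).$$ -/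

import Mathlib

open MeasureTheory

noncomputable section

namespace FlowPolytope

section QuotientMeasure

variable {ι : Type*} [Fintype ι] {E : Type*} [NormedAddCommGroup E] [NormedSpace ℝ E]
  [FiniteDimensional ℝ E] [MeasurableSpace E] [BorelSpace E]

/-- For a linear map `p : ℝ^ι → E`, with Lebesgue measure `dw` on `ℝ^ι` and a Lebesgue measure
`da = ν` on `E`: the measure `m` on `Ker p` is the quotient of `dw` by `da`. It is a Lebesgue
measure on `Ker p`, and integrating first over the fibres `p⁻¹(a) = s(a) + Ker p`
(where `s` is a linear section of `p`) and then over `a` gives the integral over `ℝ^ι`. -/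
structure IsQuotientMeasure (p : (ι → ℝ) →ₗ[ℝ] E) (ν : Measure E)
    (m : Measure (LinearMap.ker p)) : Prop where
  isAddHaar : m.IsAddHaarMeasure
  lintegral_eq : ∀ s : E →ₗ[ℝ] (ι → ℝ), p ∘ₗ s = LinearMap.id →
    ∀ f : (ι → ℝ) → ENNReal, Measurable f →
      ∫⁻ w, f w = ∫⁻ a, ∫⁻ k : LinearMap.ker p, f (s a + k) ∂m ∂ν

/-- The quotient measure `dm` on `Ker p` (see `existsUnique_isQuotientMeasure`). -/
def quotientMeasure (p : (ι → ℝ) →ₗ[ℝ] E) (ν : Measure E) : Measure (LinearMap.ker p) :=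
  open Classical in
  if h : ∃ m, IsQuotientMeasure p ν m then h.choose else 0

/-- The volume, for the quotient measure `dm`, of a subset `S` of the fibre `p⁻¹(a)`, the fibre
being identified with `Ker p` by the choice of a base point (the choice does not matter, see
`fibreVolume_eq`). -/
def fibreVolume (p : (ι → ℝ) →ₗ[ℝ] E) (ν : Measure E) (a : E) (S : Set (ι → ℝ)) : ENNReal :=
  quotientMeasure p ν {k | Function.invFun p a + (k : ι → ℝ) ∈ S}

theorem existsUnique_isQuotientMeasure (p : (ι → ℝ) →ₗ[ℝ] E) (hp : Function.Surjective p)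
    (ν : Measure E) [ν.IsAddHaarMeasure] : ∃! m, IsQuotientMeasure p ν m := by
  obtain ⟨s, hs⟩ := p.exists_rightInverse_of_surjective (LinearMap.range_eq_top.2 hp)
  have hsa : ∀ a, p (s a) = a := fun a => LinearMap.congr_fun hs a
  have hpm : Measurable p := p.continuous_of_finiteDimensional.measurable
  have hsm : ∀ t : E →ₗ[ℝ] (ι → ℝ), Measurable t := fun t =>
    t.continuous_of_finiteDimensional.measurable
  let e : (E × LinearMap.ker p) ≃ₗ[ℝ] (ι → ℝ) :=
    { toFun := fun x => s x.1 + x.2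
      map_add' := fun x y => by simp; abel
      map_smul' := fun c x => by simp
      invFun := fun w => (p w, ⟨w - s (p w), by simp [hsa]⟩)
      left_inv := fun x => by
        ext1
        · simp [hsa]
        · ext1
          simp [hsa]
      right_inv := fun w => by simp }
  have heA : ∀ a (k : LinearMap.ker p), e (a, k) = s a + k := fun a k => rfl
  have hem : Measurable e :=
    (e : (E × LinearMap.ker p) →ₗ[ℝ] (ι → ℝ)).continuous_of_finiteDimensional.measurable
  let m₀ : Measure (LinearMap.ker p) := Measure.addHaar
  have hH : ((ν.prod m₀).map e).IsAddHaarMeasure :=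
    e.toContinuousLinearEquiv.isAddHaarMeasure_map _
  obtain ⟨c, hc0, hct, hc⟩ : ∃ c : ENNReal, c ≠ 0 ∧ c ≠ ⊤ ∧
      (volume : Measure (ι → ℝ)) = c • (ν.prod m₀).map e :=
    ⟨Measure.addHaarScalarFactor volume ((ν.prod m₀).map e),
      by simpa using (Measure.addHaarScalarFactor_pos_of_isAddHaarMeasure volume _).ne',
      ENNReal.coe_ne_top, Measure.isAddLeftInvariant_eq_smul _ _⟩
  have hm₀ : IsQuotientMeasure p ν (c • m₀) := by
    refine ⟨Measure.IsAddHaarMeasure.smul m₀ hc0 hct, ?_⟩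
    intro t ht f hf
    have hta : ∀ a, p (t a) = a := fun a => LinearMap.congr_fun ht a
    have hin : ∀ a, ∫⁻ k : LinearMap.ker p, f (t a + k) ∂m₀
        = ∫⁻ k : LinearMap.ker p, f (s a + k) ∂m₀ := by
      intro a
      let d : LinearMap.ker p := ⟨t a - s a, by simp [hta, hsa]⟩
      rw [← lintegral_add_left_eq_self (μ := m₀) (fun k => f (s a + (k : ι → ℝ))) d]
      simp [d, ← add_assoc]
    have hmeas : Measurable fun x : E × LinearMap.ker p => f (e x) := hf.comp hem
    simp_rw [lintegral_smul_measure, hin]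
    rw [hc, lintegral_smul_measure, lintegral_map hf hem, lintegral_prod _ hmeas.aemeasurable]
    simp_rw [heA, smul_eq_mul]
    rw [lintegral_const_mul' _ _ hct]
  refine ⟨c • m₀, hm₀, ?_⟩
  · intro m hm
    obtain ⟨Q, hQ0, hQt, hQ⟩ : ∃ Q : Set E, ν Q ≠ 0 ∧ ν Q ≠ ⊤ ∧ MeasurableSet Q :=
      ⟨Metric.ball 0 1, (Metric.measure_ball_pos ν 0 one_pos).ne', measure_ball_lt_top.ne,
        measurableSet_ball⟩
    have key : ∀ m' : Measure (LinearMap.ker p), IsQuotientMeasure p ν m' →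
        ∀ B, MeasurableSet B → volume (e '' (Q ×ˢ B)) = m' B * ν Q := by
      intro m' hm' B hB
      have hEq : e '' (Q ×ˢ B) = e.symm ⁻¹' (Q ×ˢ B) := e.toEquiv.image_eq_preimage_symm _
      have hesm : Measurable e.symm :=
        (e.symm : (ι → ℝ) →ₗ[ℝ] (E × LinearMap.ker p)).continuous_of_finiteDimensional.measurable
      have hI : MeasurableSet (e '' (Q ×ˢ B)) := hEq ▸ hesm (hQ.prod hB)
      have hind : ∀ a (k : LinearMap.ker p), (e '' (Q ×ˢ B)).indicator (1 : (ι → ℝ) → ENNReal)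
          (s a + k) = Q.indicator 1 a * B.indicator 1 k := by
        intro a k
        have : (s a + k ∈ e '' (Q ×ˢ B)) ↔ a ∈ Q ∧ k ∈ B := by
          rw [← heA, e.injective.mem_set_image, Set.mem_prod]
        by_cases h1 : a ∈ Q <;> by_cases h2 : k ∈ B <;> simp [Set.indicator, this, h1, h2]
      rw [← lintegral_indicator_one hI,
        hm'.lintegral_eq s hs _ (measurable_one.indicator hI)]
      simp_rw [hind]
      have hB1 : Measurable (B.indicator (1 : LinearMap.ker p → ENNReal)) :=
        measurable_one.indicator hB
      simp_rw [lintegral_const_mul _ hB1, lintegral_indicator_one hB]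
      rw [lintegral_mul_const _ (measurable_one.indicator hQ), lintegral_indicator_one hQ, mul_comm]
    ext B hB
    have := (key m hm B hB).symm.trans (key _ hm₀ B hB)
    exact (ENNReal.mul_left_inj hQ0 hQt).1 this

theorem isQuotientMeasure_quotientMeasure (p : (ι → ℝ) →ₗ[ℝ] E) (hp : Function.Surjective p)
    (ν : Measure E) [ν.IsAddHaarMeasure] : IsQuotientMeasure p ν (quotientMeasure p ν) := by
  have h := (existsUnique_isQuotientMeasure p hp ν).exists
  rw [quotientMeasure, dif_pos h]
  exact h.choose_spec

theorem fibreVolume_eq (p : (ι → ℝ) →ₗ[ℝ] E) (hp : Function.Surjective p)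
    (ν : Measure E) [ν.IsAddHaarMeasure] (a : E) (S : Set (ι → ℝ)) (u : ι → ℝ) (hu : p u = a) :
    fibreVolume p ν a S = quotientMeasure p ν {k | u + (k : ι → ℝ) ∈ S} := by
  have := (isQuotientMeasure_quotientMeasure p hp ν).isAddHaar
  have hb : p (Function.invFun p a) = a := Function.invFun_eq ⟨u, hu⟩
  let d : LinearMap.ker p := ⟨Function.invFun p a - u, by simp [hb, hu]⟩
  rw [fibreVolume, ← measure_preimage_add (quotientMeasure p ν) d {k | u + (k : ι → ℝ) ∈ S}]
  congr 1
  ext k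
  simp [d, ← add_assoc]

end QuotientMeasure

/-- `E_r = {a ∈ ℝ^{r+1} : a_1 + ⋯ + a_{r+1} = 0}`. Indices run from `0` to `r` here. -/
def flowSpace (r : ℕ) : Submodule ℝ (Fin (r + 1) → ℝ) where
  carrier := {a | ∑ i, a i = 0}
  add_mem' := by
    intro a b ha hb
    simp only [Set.mem_ofPred_eq] at ha hb ⊢
    simp [Finset.sum_add_distrib, ha, hb]
  zero_mem' := by simp
  smul_mem' := by
    intro c a ha
    simp only [Set.mem_ofPred_eq] at ha ⊢
    simp [← Finset.mul_sum, ha]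

/-- The identification `ℝ^r ≃ E_r`,
`(a_1, …, a_r) ↦ a_1 e^1 + ⋯ + a_r e^r - (a_1 + ⋯ + a_r) e^{r+1}`. -/
def coordEquiv (r : ℕ) : (Fin r → ℝ) ≃ₗ[ℝ] flowSpace r where
  toFun a := ⟨Fin.snoc (α := fun _ => ℝ) a (-∑ i, a i), by
    show ∑ i, Fin.snoc (α := fun _ => ℝ) a (-∑ i, a i) i = 0
    simp [Fin.sum_univ_castSucc]⟩
  map_add' a b := by
    ext i
    refine Fin.lastCases ?_ (fun j => ?_) i
    · simp [Finset.sum_add_distrib, add_comm]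
    · simp
  map_smul' c a := by
    ext i
    refine Fin.lastCases ?_ (fun j => ?_) i
    · simp [Finset.mul_sum]
    · simp
  invFun a := fun i => a.1 i.castSucc
  left_inv a := by
    ext i
    simp
  right_inv a := by
    have ha : ∑ i, a.1 i = 0 := a.2
    rw [Fin.sum_univ_castSucc] at ha
    ext i
    refine Fin.lastCases ?_ (fun j => ?_) i
    · simp only [Fin.snoc_last]
      linarith
    · simp

/-- The measure `da = da_1 ⋯ da_r` on `E_r`. -/
def flowMeasure (r : ℕ) : Measure (flowSpace r) :=
  (volume : Measure (Fin r → ℝ)).map (coordEquiv r)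

instance (r : ℕ) : (flowMeasure r).IsAddHaarMeasure :=
  (coordEquiv r).toContinuousLinearEquiv.isAddHaarMeasure_map _

/-- The vector `e^i - e^j`. -/
def root {r : ℕ} (i j : Fin (r + 1)) : flowSpace r :=
  ⟨Pi.single i 1 - Pi.single j 1, by
    show ∑ k, (Pi.single i (1 : ℝ) - Pi.single j 1 : Fin (r + 1) → ℝ) k = 0
    simp [Finset.sum_sub_distrib]⟩

/-- The pairs `i < j`, which index the positive roots. -/
abbrev RootIndex (r : ℕ) : Type := {ij : Fin (r + 1) × Fin (r + 1) // ij.1 < ij.2}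

/-- The positive root system `A_r^+`. -/
def positiveRoots (r : ℕ) : RootIndex r → flowSpace r :=
  fun k => root k.1.1 k.1.2

/-- `A_r^+` minus the root `e^i - e^j`. -/
def positiveRootsMinus (r : ℕ) (i j : Fin (r + 1)) :
    {k : RootIndex r // k.1 ≠ (i, j)} → flowSpace r :=
  fun k => positiveRoots r k.1

section Polytope

variable {r : ℕ} {ι : Type*} [Fintype ι]

/-- The polytope `P_Φ(a)` of all `u ≥ 0` with `∑ u_k α^k = a`. -/
def polytope (Φ : ι → flowSpace r) (a : flowSpace r) : Set (ι → ℝ) :=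
  {u | (∀ k, 0 ≤ u k) ∧ ∑ k, u k • Φ k = a}

/-- The closed convex cone `C(Φ)` generated by `Φ`. -/
def cone (Φ : ι → flowSpace r) : Set (flowSpace r) :=
  {a | ∃ u : ι → ℝ, (∀ k, 0 ≤ u k) ∧ ∑ k, u k • Φ k = a}

/-- `vol P_Φ(a)`, for the quotient measure on the fibres of `u ↦ ∑ u_k α^k`. -/
def polytopeVolume (Φ : ι → flowSpace r) (a : flowSpace r) : ENNReal :=
  fibreVolume (Fintype.linearCombination ℝ Φ) (flowMeasure r) a (polytope Φ a)

variable (r) in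
/-- The nice chamber: the `a ∈ C(A_r^+)` with `a_1, …, a_r > 0`. -/
def niceChamber : Set (flowSpace r) :=
  {a | a ∈ cone (positiveRoots r) ∧ ∀ i : Fin r, 0 < a.1 i.castSucc}

/-- `v` is the polynomial `v(Φ, 𝔠⁺)` in `a_1, …, a_r`: it gives the volume of `P_Φ(a)` for all `a`
in the closure of the nice chamber. There is at most one such polynomial
(`IsVolumePolynomial.unique`). -/
def IsVolumePolynomial (Φ : ι → flowSpace r) (v : MvPolynomial (Fin r) ℝ) : Prop :=
  ∀ a ∈ closure (niceChamber r), polytopeVolume Φ a ≠ ⊤ ∧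
    (polytopeVolume Φ a).toReal = MvPolynomial.eval ((coordEquiv r).symm a) v

theorem coordEquiv_mem_niceChamber (a : Fin r → ℝ) (ha : ∀ i, 0 < a i) :
    coordEquiv r a ∈ niceChamber r := by
  refine ⟨⟨∑ i : Fin r, a i • Pi.single (⟨(i.castSucc, Fin.last r), i.castSucc_lt_last⟩ :
    RootIndex r) 1, fun k => ?_, ?_⟩, fun i => ?_⟩
  · rw [Finset.sum_apply]
    refine Finset.sum_nonneg fun i _ => ?_
    rw [Pi.smul_apply, Pi.single_apply]
    split_ifs <;> simp [(ha i).le]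
  · rw [← Fintype.linearCombination_apply ℝ, map_sum]
    simp only [map_smul, Fintype.linearCombination_apply_single, one_smul]
    ext j
    refine Fin.lastCases ?_ (fun j => ?_) j
    · simp [positiveRoots, root, coordEquiv]
    · simp [positiveRoots, root, coordEquiv, Pi.single_apply]
  · simpa [coordEquiv] using ha i

theorem IsVolumePolynomial.unique {Φ : ι → flowSpace r} {v w : MvPolynomial (Fin r) ℝ}
    (hv : IsVolumePolynomial Φ v) (hw : IsVolumePolynomial Φ w) : v = w := by
  refine MvPolynomial.funext_set (fun _ => Set.Ioi (0 : ℝ)) (fun _ => Set.Ioi_infinite 0) ?_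
  intro a ha
  have h := subset_closure (coordEquiv_mem_niceChamber a (fun i => ha i (Set.mem_univ i)))
  have h1 := (hv _ h).2
  have h2 := (hw _ h).2
  simp only [LinearEquiv.symm_apply_apply] at h1 h2
  rw [← h1, ← h2]

end Polytope

/-- The linear form `a_1 + ⋯ + a_{r-2} + 3 a_{r-1}`. The variable `a_i` is `X (i - 1)`. -/
def schmidtBincerForm (r : ℕ) (hr : 2 ≤ r) : MvPolynomial (Fin r) ℝ :=
  (∑ i : Fin r with i.val < r - 2, MvPolynomial.X i) + 3 * MvPolynomial.X ⟨r - 2, by omega⟩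

/-- The polynomial `w(a_1, …, a_{r-2}, 0, 0)`. -/
def setLastTwoZero {r : ℕ} (w : MvPolynomial (Fin r) ℝ) : MvPolynomial (Fin r) ℝ :=
  MvPolynomial.aeval (fun i : Fin r => if i.val < r - 2 then MvPolynomial.X i else 0) w

end FlowPolytope

end

/-! A point of the polytope is a nonnegative flow on the complete graph with edges i → j, i < j,
where vertex i receives a_i and the last vertex is the sink. The amounts on the edges to the sink
are determined by the others, so the volume is the Lebesgue measure of the set of flows on the
remaining, free edges that leave a nonnegative amount at every vertex
(`polytopeVolume_eq_volume_feasibleFlows`).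

Integrate over one free edge at a time, in lexicographic order. No later edge enters the source i of
the current edge (i, j), so the amount s sent along it ranges exactly over [0, a_i]. Hence the
volume is obtained by applying to 1 the operators f ↦ ∫₀^{a_i} f(a - s e^i + s e^j) ds, which
preserve polynomials (`volume_feasibleFlows`).

Let p, q be the last two vertices before the sink. The edge (p, q) is innermost and turns 1 into
X_p, so with D the composite of all the other operators, v = D(X_p) and w = D(1). The identity 3
D(X_p) = (∑ X_k + 3 X_p) D(1) is proved by induction, adding a vertex in front
(`three_mul_edgesOp_edgeList`). Operators create no variable but their source, so w does not involve
X_p, X_q; this gives the degree bound in a_{r-1}, the independence of a_r, and makes setting these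
variables to zero harmless. Each edge leaving the first vertex contributes one factor a_1. -/

noncomputable section

open MeasureTheory

namespace FlowPolytope

/-! ### Integration along one edge as an operator on polynomials -/

section EdgeOperator

open MvPolynomial

/-- The integral over `[0, 1]` of a real polynomial in one variable. -/
def unitIntegral : Polynomial ℝ →ₗ[ℝ] ℝ where
  toFun c := ∫ t in (0 : ℝ)..1, c.eval t
  map_add' c d := by
    simp only [Polynomial.eval_add]
    exact intervalIntegral.integral_add (c.continuous.intervalIntegrable _ _)
      (d.continuous.intervalIntegrable _ _)
  map_smul' x c := by simp

variable {σ : Type*}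

/-- Integrate the coefficients of a polynomial over the unit interval. -/
def integrateCoeffs (g : MvPolynomial σ (Polynomial ℝ)) : MvPolynomial σ ℝ :=
  .ofCoeff (Finsupp.mapRange unitIntegral (map_zero _) (AddMonoidAlgebra.coeff g))

theorem coeff_integrateCoeffs (g : MvPolynomial σ (Polynomial ℝ)) (m : σ →₀ ℕ) :
    coeff m (integrateCoeffs g) = unitIntegral (coeff m g) := rfl

theorem integrateCoeffs_add (g h : MvPolynomial σ (Polynomial ℝ)) :
    integrateCoeffs (g + h) = integrateCoeffs g + integrateCoeffs h := by
  ext m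
  simp [coeff_integrateCoeffs]

theorem integrateCoeffs_monomial (m : σ →₀ ℕ) (c : Polynomial ℝ) :
    integrateCoeffs (monomial m c) = monomial m (unitIntegral c) := by
  classical
  ext k
  simp only [coeff_integrateCoeffs, coeff_monomial]
  split_ifs <;> simp

theorem X_pow_dvd_integrateCoeffs (i : σ) (n : ℕ) (g : MvPolynomial σ (Polynomial ℝ)) :
    X i ^ n ∣ integrateCoeffs (X i ^ n * g) := by
  induction g using MvPolynomial.induction_on' with
  | add g h hg hh =>
    rw [mul_add, integrateCoeffs_add]
    exact dvd_add hg hh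
  | monomial m c =>
    rw [X_pow_eq_monomial, X_pow_eq_monomial, monomial_mul, integrateCoeffs_monomial]
    exact ⟨monomial m (unitIntegral (1 * c)), by simp [monomial_mul]⟩

theorem support_integrateCoeffs_subset (g : MvPolynomial σ (Polynomial ℝ)) :
    (integrateCoeffs g).support ⊆ g.support := by
  intro m hm
  rw [mem_support_iff, coeff_integrateCoeffs] at hm
  rw [mem_support_iff]
  rintro h
  simp [h] at hm

theorem isHomogeneous_integrateCoeffs {g : MvPolynomial σ (Polynomial ℝ)} {d : ℕ}
    (hg : g.IsHomogeneous d) : (integrateCoeffs g).IsHomogeneous d := by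
  intro m hm
  exact hg (mem_support_iff.1 (support_integrateCoeffs_subset g (mem_support_iff.2 hm)))

theorem integrateCoeffs_mem_supported {g : MvPolynomial σ (Polynomial ℝ)} {s : Set σ}
    (hg : g ∈ supported (Polynomial ℝ) s) : integrateCoeffs g ∈ supported ℝ s := by
  rw [mem_supported] at hg ⊢
  intro k hk
  obtain ⟨m, hm, hkm⟩ := (mem_vars_iff_mem_support k).1 hk
  exact hg ((mem_vars_iff_mem_support k).2 ⟨m, support_integrateCoeffs_subset g hm, hkm⟩)

/-- `eval` commutes with the integration of the coefficients. -/
theorem eval_integrateCoeffs (g : MvPolynomial σ (Polynomial ℝ)) (a : σ → ℝ) :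
    eval a (integrateCoeffs g) =
      ∫ t in (0 : ℝ)..1, (eval (fun k => Polynomial.C (a k)) g).eval t := by
  change _ = unitIntegral _
  induction g using MvPolynomial.induction_on' with
  | add g h hg hh => rw [integrateCoeffs_add, map_add, map_add, map_add, hg, hh]
  | monomial m c =>
    have : (m.prod fun n e => Polynomial.C (a n) ^ e) =
        Polynomial.C (m.prod fun n e => a n ^ e) := by
      simp [Finsupp.prod, map_prod]
    rw [integrateCoeffs_monomial, eval_monomial, eval_monomial, this, mul_comm c,
      ← Polynomial.smul_eq_C_mul, map_smul, smul_eq_mul, mul_comm]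

variable [DecidableEq σ]

/-- The point reached from `a` when the amount `s` is moved from `i` to `j`. -/
def moveFlow (i j : σ) (a : σ → ℝ) (s : ℝ) : σ → ℝ :=
  a - s • (Pi.single i 1 - Pi.single j 1)

/-- Substitution of the proportion `t` of the variable `X i` moved to `X j`. -/
def moveHom (i j : σ) : MvPolynomial σ ℝ →ₐ[ℝ] MvPolynomial σ (Polynomial ℝ) :=
  aeval fun k => X k - C Polynomial.X * X i * ((Pi.single i 1 - Pi.single j 1 : σ → _) k)

/-- The indeterminate of the coefficient ring stands for the proportion t. Moving t a_i rather than
s fixes the range of integration to [0, 1], so that integration can be done coefficientwise and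
yields a polynomial. -/
theorem eval_moveHom (i j : σ) (f : MvPolynomial σ ℝ) (a : σ → ℝ) (t : ℝ) :
    (eval (fun k => Polynomial.C (a k)) (moveHom i j f)).eval t =
      eval (moveFlow i j a (t * a i)) f := by
  induction f using MvPolynomial.induction_on with
  | C c =>
    have : moveHom i j (C c) = C (Polynomial.C c) := by
      rw [moveHom, aeval_C]
      rfl
    simp [this]
  | add p q hp hq => simp [hp, hq]
  | mul_X p k hp =>
    rw [map_mul, map_mul, Polynomial.eval_mul, hp, map_mul]
    congr 1
    simp only [moveHom, aeval_X, moveFlow, Pi.sub_apply, Pi.smul_apply, Pi.single_apply, eval_X,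
      smul_eq_mul]
    split_ifs <;> simp <;> ring

/-- The operator `f ↦ (a ↦ ∫₀^{a_i} f(a - s e^i + s e^j) ds)` on polynomials. -/
def edgeOp (e : σ × σ) (f : MvPolynomial σ ℝ) : MvPolynomial σ ℝ :=
  X e.1 * integrateCoeffs (moveHom e.1 e.2 f)

/-- Substitute s = t a_i; the prefactor `X e.1` is the Jacobian. The sign of a_i plays no role for
interval integrals. -/
theorem eval_edgeOp (e : σ × σ) (f : MvPolynomial σ ℝ) (a : σ → ℝ) :
    eval a (edgeOp e f) = ∫ s in (0 : ℝ)..(a e.1), eval (moveFlow e.1 e.2 a s) f := by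
  rw [edgeOp, map_mul, eval_X, eval_integrateCoeffs]
  simp only [eval_moveHom]
  have := intervalIntegral.mul_integral_comp_mul_right
    (f := fun s => eval (moveFlow e.1 e.2 a s) f) (a := 0) (b := 1) (c := a e.1)
  simpa using this

theorem continuous_eval_moveFlow (i j : σ) (a : σ → ℝ) (f : MvPolynomial σ ℝ) :
    Continuous fun s => eval (moveFlow i j a s) f := by
  refine (MvPolynomial.continuous_eval f).comp (continuous_pi fun k => ?_)
  simp only [moveFlow, Pi.sub_apply, Pi.smul_apply, smul_eq_mul]
  fun_prop

theorem edgeOp_mul_of_invariant (e : σ × σ) (h f : MvPolynomial σ ℝ)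
    (hh : ∀ a s, eval (moveFlow e.1 e.2 a s) h = eval a h) :
    edgeOp e (h * f) = h * edgeOp e f := by
  refine MvPolynomial.funext fun a => ?_
  simp [eval_edgeOp, hh]

theorem edgeOp_add (e : σ × σ) (f g : MvPolynomial σ ℝ) :
    edgeOp e (f + g) = edgeOp e f + edgeOp e g := by
  rw [edgeOp, map_add, integrateCoeffs_add, mul_add, edgeOp, edgeOp]

theorem isHomogeneous_edgeOp (e : σ × σ) {f : MvPolynomial σ ℝ} {d : ℕ}
    (hf : f.IsHomogeneous d) : (edgeOp e f).IsHomogeneous (d + 1) := by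
  rw [add_comm d, edgeOp]
  refine (isHomogeneous_X _ _).mul (isHomogeneous_integrateCoeffs ?_)
  have := hf.aeval (n := 1) (S := Polynomial ℝ) (fun k => X k - C Polynomial.X * X e.1 *
    ((Pi.single e.1 1 - Pi.single e.2 1 : σ → MvPolynomial σ (Polynomial ℝ)) k)) fun k => by
      refine (isHomogeneous_X _ _).sub ?_
      refine ((isHomogeneous_C _ _).mul (isHomogeneous_X _ _)).mul (n := 0) ?_
      refine IsHomogeneous.sub ?_ ?_ <;>
      · rw [Pi.single_apply]
        split_ifs
        exacts [isHomogeneous_one _ _, isHomogeneous_zero _ _ _]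
  rwa [one_mul] at this

/-- The substitution replaces X_j by X_j + t X_i, so the source may appear as a new variable but the
target never does. -/
theorem edgeOp_mem_supported (e : σ × σ) {f : MvPolynomial σ ℝ} {s : Set σ} (he : e.1 ∈ s)
    (hf : f ∈ supported ℝ s) : edgeOp e f ∈ supported ℝ s := by
  refine mul_mem (X_mem_supported.2 he) (integrateCoeffs_mem_supported ?_)
  have : supported ℝ s ≤ ((supported (Polynomial ℝ) s).restrictScalars ℝ).comap
      (moveHom e.1 e.2) := by
    rw [supported_eq_adjoin_X, Algebra.adjoin_le_iff]
    rintro _ ⟨k, hk, rfl⟩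
    change moveHom e.1 e.2 (X k) ∈ supported (Polynomial ℝ) s
    rw [moveHom, aeval_X]
    refine sub_mem (X_mem_supported.2 hk) (mul_mem (mul_mem ?_ (X_mem_supported.2 he)) ?_)
    · exact Subalgebra.algebraMap_mem _ _
    · refine sub_mem ?_ ?_ <;>
      · rw [Pi.single_apply]
        split_ifs
        exacts [one_mem _, zero_mem _]
  exact this hf

/-- The substitution sends X_i to (1 - t) X_i, so X_i^n survives the integration in t, and the
prefactor X_i supplies one more power. -/
theorem X_pow_dvd_edgeOp (i j : σ) (hij : i ≠ j) {f : MvPolynomial σ ℝ} {n : ℕ}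
    (hf : X i ^ n ∣ f) : X i ^ (n + 1) ∣ edgeOp (i, j) f := by
  obtain ⟨h, rfl⟩ := hf
  have : moveHom i j (X i ^ n * h) =
      X i ^ n * ((1 - C Polynomial.X) ^ n * moveHom i j h) := by
    rw [map_mul, map_pow, ← mul_assoc, ← mul_pow]
    congr 2
    simp [moveHom, hij]
    ring
  rw [edgeOp, this, pow_succ']
  exact mul_dvd_mul_left _ (X_pow_dvd_integrateCoeffs i n _)

/-- The composite of the operators of a list of edges. -/
def edgesOp (L : List (σ × σ)) (f : MvPolynomial σ ℝ) : MvPolynomial σ ℝ :=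
  L.foldr edgeOp f

theorem edgesOp_append (L M : List (σ × σ)) (f : MvPolynomial σ ℝ) :
    edgesOp (L ++ M) f = edgesOp L (edgesOp M f) := List.foldr_append ..

theorem isHomogeneous_edgesOp (L : List (σ × σ)) {f : MvPolynomial σ ℝ} {d : ℕ}
    (hf : f.IsHomogeneous d) : (edgesOp L f).IsHomogeneous (d + L.length) := by
  induction L with
  | nil => exact hf
  | cons e L ih => exact isHomogeneous_edgeOp e ih

theorem edgesOp_mem_supported (L : List (σ × σ)) {f : MvPolynomial σ ℝ} {s : Set σ}
    (hL : ∀ e ∈ L, e.1 ∈ s) (hf : f ∈ supported ℝ s) : edgesOp L f ∈ supported ℝ s := by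
  induction L with
  | nil => exact hf
  | cons e L ih =>
    exact edgeOp_mem_supported e (hL e (by simp)) (ih fun e he => hL e (by simp [he]))

theorem X_pow_dvd_edgesOp (i : σ) (l : List σ) (hl : i ∉ l) (f : MvPolynomial σ ℝ) :
    X i ^ l.length ∣ edgesOp (l.map (i, ·)) f := by
  induction l with
  | nil => simp
  | cons j l ih =>
    simp only [List.mem_cons, not_or] at hl
    exact X_pow_dvd_edgeOp i j hl.1 (ih hl.2)

end EdgeOperator

/-! ### The factorization identity, by induction on the vertices -/

section EdgeList

open MvPolynomial

variable {σ : Type*}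

/-- The edges from each element of `l` to the later elements of `l` and to `p` and `q`. -/
def edgeList (p q : σ) : List σ → List (σ × σ)
  | [] => []
  | i :: l => (l ++ [p, q]).map (i, ·) ++ edgeList p q l

theorem fst_mem_of_mem_edgeList {p q : σ} {l : List σ} {e : σ × σ} (he : e ∈ edgeList p q l) :
    e.1 ∈ l := by
  induction l with
  | nil => simp [edgeList] at he
  | cons i l ih =>
    rw [edgeList, List.mem_append] at he
    rcases he with he | he
    · obtain ⟨j, -, rfl⟩ := List.mem_map.1 he
      simp
    · exact List.mem_cons_of_mem _ (ih he)

/-- All pairs among the vertices of `l ++ [p, q]` occur, except (p, q), which the `+ 1` restores. -/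
theorem length_edgeList (p q : σ) (l : List σ) :
    2 * ((edgeList p q l).length + 1) = (l.length + 2) * (l.length + 1) := by
  induction l with
  | nil => rfl
  | cons i l ih =>
    simp only [edgeList, List.length_append, List.length_map, List.length_cons, List.length_nil]
    linarith

variable [DecidableEq σ]

theorem eval_moveFlow_of_mem_supported {i j : σ} {s : Set σ} (hi : i ∉ s) (hj : j ∉ s)
    {g : MvPolynomial σ ℝ} (hg : g ∈ supported ℝ s) (a : σ → ℝ) (t : ℝ) :
    eval (moveFlow i j a t) g = eval a g := by
  refine eval₂Hom_congr' rfl (fun k hk _ => ?_) rfl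
  have hks := mem_supported.1 hg hk
  have hki : k ≠ i := fun h => hi (h ▸ hks)
  have hkj : k ≠ j := fun h => hj (h ▸ hks)
  simp [moveFlow, hki, hkj]

theorem edgeOp_one (i j : σ) : edgeOp (i, j) 1 = X i := by
  refine MvPolynomial.funext fun a => ?_
  simp [eval_edgeOp]

/-- The origin of the constant 3: ∫₀^a (b + s)(a - s) ds = a²b/2 + a³/6 = (a + 3b)/3 · a²/2, with a
= a_i and b = a_p. -/
theorem three_mul_edgeOp_X_mul_X {i p : σ} (hip : i ≠ p) :
    3 * edgeOp (i, p) (X p * X i) = (X i + 3 * X p) * edgeOp (i, p) (X i) := by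
  refine MvPolynomial.funext fun a => ?_
  have h1 : ∫ s in (0 : ℝ)..(a i), (a i - s) = a i ^ 2 / 2 := by
    rw [intervalIntegral.integral_sub (by simp) (by simp)]
    simp
    ring
  have h2 : ∫ s in (0 : ℝ)..(a i), (a p + s) * (a i - s) =
      a p * a i ^ 2 / 2 + a i ^ 3 / 6 := by
    have : ∀ s : ℝ, (a p + s) * (a i - s) = a p * a i + (a i - a p) * s - s ^ 2 := by
      intro s; ring
    simp_rw [this]
    rw [intervalIntegral.integral_sub (Continuous.intervalIntegrable (by fun_prop) _ _)
        (Continuous.intervalIntegrable (by fun_prop) _ _),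
      intervalIntegral.integral_add (Continuous.intervalIntegrable (by fun_prop) _ _)
        (Continuous.intervalIntegrable (by fun_prop) _ _),
      intervalIntegral.integral_const_mul (a i - a p) fun s => s]
    simp
    ring
  simp only [map_mul, map_add, map_ofNat, eval_edgeOp, eval_X, moveFlow, Pi.sub_apply,
    Pi.smul_apply, Pi.single_eq_same, Pi.single_eq_of_ne hip, Pi.single_eq_of_ne hip.symm,
    smul_eq_mul, zero_sub, mul_neg, mul_one, sub_neg_eq_add, sub_zero, h1, h2]
  ring

theorem edgesOp_mul_of_invariant (L : List (σ × σ)) (h f : MvPolynomial σ ℝ)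
    (hh : ∀ e ∈ L, ∀ a s, eval (moveFlow e.1 e.2 a s) h = eval a h) :
    edgesOp L (h * f) = h * edgesOp L f := by
  induction L with
  | nil => rfl
  | cons e L ih =>
    have := ih fun e he => hh e (by simp [he])
    simp only [edgesOp, List.foldr_cons] at this ⊢
    rw [this, edgeOp_mul_of_invariant e _ _ (hh e (by simp))]

theorem edgesOp_edgeList_one_mem_supported (p q : σ) (l : List σ) :
    edgesOp (edgeList p q l) 1 ∈ supported ℝ {k | k ∈ l} :=
  edgesOp_mem_supported _ (fun _ he => fst_mem_of_mem_edgeList he) (one_mem _)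

/-- For a new first vertex i, the two innermost edges (i, p), (i, q) add X_i to the linear form. The
edges from i to `l` then leave the enlarged form invariant, since they move flow between variables
of coefficient 1. -/
theorem three_mul_edgesOp_edgeList {p q : σ} {l : List σ} (hl : (l ++ [p, q]).Nodup) :
    3 * edgesOp (edgeList p q l) (X p) =
      (∑ k ∈ l.toFinset, X k + 3 * X p) * edgesOp (edgeList p q l) 1 := by
  induction l with
  | nil => simp [edgeList, edgesOp]
  | cons i l ih =>
    simp only [List.cons_append, List.nodup_cons, List.mem_append, List.mem_cons,
      List.not_mem_nil, or_false, not_or] at hl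
    obtain ⟨⟨hil, hip, hiq⟩, hl⟩ := hl
    have ih := ih hl
    obtain ⟨hln, hpq, hdis⟩ := List.nodup_append.1 hl
    have hpl : p ∉ l := fun h => hdis p h p (by simp) rfl
    have hql : q ∉ l := fun h => hdis q h q (by simp) rfl
    have hpq : p ≠ q := by simpa using hpq
    set g := edgesOp (edgeList p q l) 1 with hgdef
    have hg : g ∈ supported ℝ {k | k ∈ l} := edgesOp_edgeList_one_mem_supported p q l
    have hS : ∑ k ∈ l.toFinset, X k ∈ supported ℝ {k | k ∈ l} :=
      sum_mem fun k hk => X_mem_supported.2 (List.mem_toFinset.1 hk)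
    set S : MvPolynomial σ ℝ := ∑ k ∈ l.toFinset, X k with hSdef
    -- Flow along (i, p) and (i, q) does not touch the vertices of `l`, so polynomials in their
    -- variables, in particular `g` and `S`, act as constants.
    have hpull : ∀ f ∈ supported ℝ {k | k ∈ l}, ∀ h : MvPolynomial σ ℝ,
        edgeOp (i, p) (edgeOp (i, q) (f * h)) = f * edgeOp (i, p) (edgeOp (i, q) h) := by
      intro f hf h
      rw [edgeOp_mul_of_invariant (i, q) f h
          (eval_moveFlow_of_mem_supported (s := {k | k ∈ l}) hil hql hf),
        edgeOp_mul_of_invariant (i, p) f _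
          (eval_moveFlow_of_mem_supported (s := {k | k ∈ l}) hil hpl hf)]
    have hXp : edgeOp (i, q) (X p) = X p * X i := by
      have := edgeOp_mul_of_invariant (i, q) (X p) 1 (fun a s => by
        simp [moveFlow, hpq, Ne.symm hip])
      rwa [mul_one, edgeOp_one] at this
    have h3 : (3 : MvPolynomial σ ℝ) ∈ supported ℝ {k | k ∈ l} := ofNat_mem _ 3
    have key : edgeOp (i, p) (edgeOp (i, q) ((S + 3 * X p) * g)) =
        (X i + S + 3 * X p) * edgeOp (i, p) (edgeOp (i, q) g) := by
      have e1 := hpull g hg 1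
      rw [mul_one, edgeOp_one] at e1
      have e2 := hpull S hS 1
      rw [mul_one, edgeOp_one] at e2
      rw [mul_comm _ g, hpull g hg, edgeOp_add, edgeOp_add, e1, e2, hpull 3 h3, hXp,
        three_mul_edgeOp_X_mul_X hip]
      ring
    have hconst : edgesOp ((l ++ [p, q]).map (i, ·)) (3 * edgesOp (edgeList p q l) (X p)) =
        3 * edgesOp ((l ++ [p, q]).map (i, ·)) (edgesOp (edgeList p q l) (X p)) :=
      edgesOp_mul_of_invariant _ _ _ fun e _ a s => by simp
    rw [edgeList, edgesOp_append, edgesOp_append, ← hconst, ih, List.map_append, edgesOp_append,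
      edgesOp_append]
    change edgesOp _ (edgeOp (i, p) (edgeOp (i, q) ((S + 3 * X p) * g))) =
      _ * edgesOp _ (edgeOp (i, p) (edgeOp (i, q) g))
    rw [key, List.toFinset_cons, Finset.sum_insert (by simpa using hil), ← hSdef]
    -- It remains to pull the form X_i + S + 3 X_p through the edges (i, j) with j in `l`: X_i loses
    -- s and S gains s.
    refine edgesOp_mul_of_invariant _ _ _ fun e he a s => ?_
    obtain ⟨j, hj, rfl⟩ := List.mem_map.1 he
    have hji : j ≠ i := fun h => hil (h ▸ hj)
    have hjp : j ≠ p := fun h => hpl (h ▸ hj)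
    have hsum : ∑ k ∈ l.toFinset, moveFlow i j a s k = ∑ k ∈ l.toFinset, a k + s := by
      simp [moveFlow, Finset.sum_sub_distrib, ← Finset.mul_sum, hil, hj]
    simp only [hSdef, map_add, map_sum, eval_X, map_mul, map_ofNat, hsum]
    simp [moveFlow, hji.symm, hjp.symm, Ne.symm hip]

end EdgeList

/-! ### Reduction of the quotient measure to Lebesgue measure on the free edges -/

section FreeEdges

variable {r : ℕ} {κ : Type*} [Fintype κ]

/-- The net outflow at each vertex of the flow `x` on the edges `E`. -/
def netOutflow (E : κ → Fin r × Fin r) : (κ → ℝ) →ₗ[ℝ] (Fin r → ℝ) :=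
  Fintype.linearCombination ℝ fun k => Pi.single (E k).1 1 - Pi.single (E k).2 1

/-- The flows `x ≥ 0` on the edges `E` which leave a nonnegative amount at each vertex, when the
vertex `i` receives `b i`. -/
def feasibleFlows (E : κ → Fin r × Fin r) (b : Fin r → ℝ) : Set (κ → ℝ) :=
  {x | (∀ k, 0 ≤ x k) ∧ ∀ i, 0 ≤ b i - netOutflow E x i}

theorem measurableSet_feasibleFlows (E : κ → Fin r × Fin r) (b : Fin r → ℝ) :
    MeasurableSet (feasibleFlows E b) := by
  have hN : Measurable (netOutflow E) :=
    (netOutflow E).continuous_of_finiteDimensional.measurable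
  have : feasibleFlows E b =
      (⋂ k, {x | 0 ≤ x k}) ∩ ⋂ i, {x | 0 ≤ b i - netOutflow E x i} := by
    ext x
    simp [feasibleFlows]
  rw [this]
  refine (MeasurableSet.iInter fun k => ?_).inter (MeasurableSet.iInter fun i => ?_)
  · exact measurableSet_le measurable_const (measurable_pi_apply k)
  · exact measurableSet_le measurable_const
      (measurable_const.sub ((measurable_pi_apply i).comp hN))

variable {ι : Type*} [Fintype ι]

/-- The flow with the amounts `x` on the edges `E`, where the edges to the last vertex carry what
is left of `b`. -/
def completeFlow (e : Fin r ⊕ κ ≃ ι) (E : κ → Fin r × Fin r) :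
    ((Fin r → ℝ) × (κ → ℝ)) ≃ₗ[ℝ] (ι → ℝ) where
  toFun y := fun k => Sum.elim (y.1 - netOutflow E y.2) y.2 (e.symm k)
  map_add' y z := by
    ext k
    rcases h : e.symm k with i | i <;> simp [h]
    ring
  map_smul' c y := by
    ext k
    rcases h : e.symm k with i | i <;> simp [h]
    ring
  invFun w := (fun i => w (e (.inl i)) + netOutflow E (fun k => w (e (.inr k))) i,
    fun k => w (e (.inr k)))
  left_inv y := by
    ext i <;> simp
  right_inv w := by
    ext k
    obtain ⟨i | i, rfl⟩ := e.surjective k <;> simp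

variable {Φ : ι → flowSpace r} {e : Fin r ⊕ κ ≃ ι} {E : κ → Fin r × Fin r}

/-- The edge from i to the sink carries b_i minus the net outflow along free edges, so the total
outflow at i is b_i. -/
theorem linearCombination_completeFlow
    (hl : ∀ i, Φ (e (.inl i)) = root i.castSucc (Fin.last r))
    (hr : ∀ k, Φ (e (.inr k)) = root (E k).1.castSucc (E k).2.castSucc)
    (y : (Fin r → ℝ) × (κ → ℝ)) :
    Fintype.linearCombination ℝ Φ (completeFlow e E y) = coordEquiv r y.1 := by
  apply (coordEquiv r).symm.injective
  rw [LinearEquiv.symm_apply_apply, Fintype.linearCombination_apply, map_sum,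
    ← e.sum_comp, Fintype.sum_sum_type]
  have h1 : ∀ i, (coordEquiv r).symm (root i.castSucc (Fin.last r)) = Pi.single i 1 := by
    intro i
    ext j
    simp [coordEquiv, root, Pi.single_apply]
  have h2 : ∀ i j : Fin r, (coordEquiv r).symm (root i.castSucc j.castSucc) =
      Pi.single i 1 - Pi.single j 1 := by
    intro i j
    ext k
    simp [coordEquiv, root, Pi.single_apply]
  simp only [map_smul, hl, hr, h1, h2]
  have h3 : ∑ i, completeFlow e E y (e (.inl i)) • (Pi.single i 1 : Fin r → ℝ) =
      y.1 - netOutflow E y.2 := by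
    ext j
    simp [completeFlow, Finset.sum_apply, Pi.single_apply]
  rw [h3]
  have h4 : ∑ k, completeFlow e E y (e (.inr k)) •
      (Pi.single (E k).1 1 - Pi.single (E k).2 1 : Fin r → ℝ) = netOutflow E y.2 := by
    simp [completeFlow, netOutflow, Fintype.linearCombination_apply]
  rw [h4, sub_add_cancel]

/-- For fixed x, `completeFlow` only translates b by the net outflow of x; this shear preserves
Lebesgue measure. -/
theorem lintegral_completeFlow (f : (ι → ℝ) → ENNReal) (hf : Measurable f) :
    ∫⁻ w, f w = ∫⁻ b : Fin r → ℝ, ∫⁻ x : κ → ℝ, f (completeFlow e E (b, x)) := by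
  have hmp : MeasurePreserving
      (fun y : (Fin r → ℝ) × (κ → ℝ) => fun k : ι => Sum.elim y.1 y.2 (e.symm k)) := by
    have h1 := (volume_measurePreserving_piCongrLeft (fun _ : ι => ℝ) e).comp
      (volume_measurePreserving_sumPiEquivProdPi_symm (fun _ : Fin r ⊕ κ => ℝ))
    refine (congrArg (fun F => MeasurePreserving F volume volume) ?_).mpr h1
    funext y k
    obtain ⟨i, rfl⟩ := e.surjective k
    rw [Function.comp_apply, MeasurableEquiv.coe_piCongrLeft, Equiv.piCongrLeft_apply_apply,
      Equiv.symm_apply_apply]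
    cases i <;> rfl
  have hm : Measurable fun y : (Fin r → ℝ) × (κ → ℝ) =>
      f fun k => Sum.elim y.1 y.2 (e.symm k) := hf.comp hmp.measurable
  have hmc : Measurable fun y : (Fin r → ℝ) × (κ → ℝ) => f (completeFlow e E y) :=
    hf.comp (completeFlow e E).toContinuousLinearEquiv.continuous.measurable
  rw [← hmp.lintegral_comp hf, Measure.volume_eq_prod, lintegral_prod_symm _ hm.aemeasurable,
    lintegral_lintegral_swap (f := fun b x => f (completeFlow e E (b, x))) hmc.aemeasurable]
  refine lintegral_congr fun x => ?_
  exact (lintegral_sub_right_eq_self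
    (fun b : Fin r → ℝ => f fun k => Sum.elim b x (e.symm k)) (netOutflow E x)).symm

/-- The free edges parametrize the kernel of `u ↦ ∑ u_k α^k`. -/
def freeEdgesEquivKer (hl : ∀ i, Φ (e (.inl i)) = root i.castSucc (Fin.last r))
    (hr : ∀ k, Φ (e (.inr k)) = root (E k).1.castSucc (E k).2.castSucc) :
    (κ → ℝ) ≃ₗ[ℝ] LinearMap.ker (Fintype.linearCombination ℝ Φ) where
  toFun x := ⟨completeFlow e E (0, x), by
    rw [LinearMap.mem_ker, linearCombination_completeFlow hl hr, map_zero]⟩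
  map_add' x y := by
    ext1
    simp [← map_add]
  map_smul' c x := by
    ext1
    simp [← map_smul]
  invFun k := ((completeFlow e E).symm k).2
  left_inv x := by simp
  right_inv k := by
    have h := linearCombination_completeFlow hl hr ((completeFlow e E).symm k)
    rw [LinearEquiv.apply_symm_apply, LinearMap.mem_ker.1 k.2] at h
    have h0 : ((completeFlow e E).symm k).1 = 0 := by
      apply (coordEquiv r).injective
      rw [← h, map_zero]
    ext1
    change completeFlow e E (0, _) = _
    rw [← h0]
    simp

theorem completeFlow_add_freeEdgesEquivKer
    (hl : ∀ i, Φ (e (.inl i)) = root i.castSucc (Fin.last r))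
    (hr : ∀ k, Φ (e (.inr k)) = root (E k).1.castSucc (E k).2.castSucc)
    (b : Fin r → ℝ) (x : κ → ℝ) :
    completeFlow e E (b, 0) + (freeEdgesEquivKer hl hr x : ι → ℝ) = completeFlow e E (b, x) := by
  change _ + completeFlow e E (0, x) = _
  rw [← map_add]
  simp

/-- Over each point, an arbitrary section differs from `completeFlow e E (b, 0)` by a kernel
element, which a translation-invariant measure does not see; what remains is
`lintegral_completeFlow`. -/
theorem isQuotientMeasure_map_freeEdgesEquivKer
    (hl : ∀ i, Φ (e (.inl i)) = root i.castSucc (Fin.last r))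
    (hr : ∀ k, Φ (e (.inr k)) = root (E k).1.castSucc (E k).2.castSucc) :
    IsQuotientMeasure (Fintype.linearCombination ℝ Φ) (flowMeasure r)
      ((volume : Measure (κ → ℝ)).map (freeEdgesEquivKer hl hr)) := by
  have hH : ((volume : Measure (κ → ℝ)).map (freeEdgesEquivKer hl hr)).IsAddHaarMeasure :=
    (freeEdgesEquivKer hl hr).toContinuousLinearEquiv.isAddHaarMeasure_map _
  refine ⟨hH, fun s hs f hf => ?_⟩
  have hsa : ∀ a, Fintype.linearCombination ℝ Φ (s a) = a := fun a => LinearMap.congr_fun hs a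
  have hin : ∀ b : Fin r → ℝ,
      ∫⁻ k : LinearMap.ker (Fintype.linearCombination ℝ Φ), f (s (coordEquiv r b) + k)
        ∂((volume : Measure (κ → ℝ)).map (freeEdgesEquivKer hl hr)) =
      ∫⁻ x : κ → ℝ, f (completeFlow e E (b, x)) := by
    intro b
    let d : LinearMap.ker (Fintype.linearCombination ℝ Φ) :=
      ⟨s (coordEquiv r b) - completeFlow e E (b, 0), by
        rw [LinearMap.mem_ker, map_sub, hsa, linearCombination_completeFlow hl hr, sub_self]⟩
    have h1 := lintegral_add_left_eq_self
      (μ := (volume : Measure (κ → ℝ)).map (freeEdgesEquivKer hl hr))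
      (fun k => f (completeFlow e E (b, 0) + (k : ι → ℝ))) d
    have h2 : ∀ k : LinearMap.ker (Fintype.linearCombination ℝ Φ),
        completeFlow e E (b, 0) + ((d + k : LinearMap.ker _) : ι → ℝ) =
          s (coordEquiv r b) + k := by
      intro k
      simp [d, ← add_assoc]
    simp only [h2] at h1
    have hemb : MeasurableEmbedding (freeEdgesEquivKer hl hr) :=
      (freeEdgesEquivKer hl hr).toContinuousLinearEquiv.toHomeomorph.measurableEmbedding
    rw [h1, hemb.lintegral_map]
    simp only [completeFlow_add_freeEdgesEquivKer]
  have hemb : MeasurableEmbedding (coordEquiv r) :=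
    (coordEquiv r).toContinuousLinearEquiv.toHomeomorph.measurableEmbedding
  rw [lintegral_completeFlow (e := e) (E := E) f hf, flowMeasure, hemb.lintegral_map]
  simp only [hin]

theorem surjective_linearCombination
    (hl : ∀ i, Φ (e (.inl i)) = root i.castSucc (Fin.last r))
    (hr : ∀ k, Φ (e (.inr k)) = root (E k).1.castSucc (E k).2.castSucc) :
    Function.Surjective (Fintype.linearCombination ℝ Φ) := by
  intro a
  refine ⟨completeFlow e E ((coordEquiv r).symm a, 0), ?_⟩
  rw [linearCombination_completeFlow hl hr, LinearEquiv.apply_symm_apply]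

theorem polytopeVolume_eq_volume_feasibleFlows
    (hl : ∀ i, Φ (e (.inl i)) = root i.castSucc (Fin.last r))
    (hr : ∀ k, Φ (e (.inr k)) = root (E k).1.castSucc (E k).2.castSucc) (a : flowSpace r) :
    polytopeVolume Φ a = volume (feasibleFlows E ((coordEquiv r).symm a)) := by
  have hsurj := surjective_linearCombination hl hr
  have hq : quotientMeasure (Fintype.linearCombination ℝ Φ) (flowMeasure r) =
      (volume : Measure (κ → ℝ)).map (freeEdgesEquivKer hl hr) :=
    (existsUnique_isQuotientMeasure _ hsurj (flowMeasure r)).unique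
      (isQuotientMeasure_quotientMeasure _ hsurj _)
      (isQuotientMeasure_map_freeEdgesEquivKer hl hr)
  have hemb : MeasurableEmbedding (freeEdgesEquivKer hl hr) :=
    (freeEdgesEquivKer hl hr).toContinuousLinearEquiv.toHomeomorph.measurableEmbedding
  set b := (coordEquiv r).symm a with hb
  have hba : coordEquiv r b = a := by simp [hb]
  rw [polytopeVolume, fibreVolume_eq _ hsurj _ a _ (completeFlow e E (b, 0))
    (by rw [linearCombination_completeFlow hl hr, hba]), hq, hemb.map_apply]
  congr 1
  ext x
  have hx := linearCombination_completeFlow hl hr (b, x)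
  rw [Fintype.linearCombination_apply, hba] at hx
  simp only [Set.mem_preimage, Set.mem_ofPred_eq, completeFlow_add_freeEdgesEquivKer, polytope,
    hx, and_true, feasibleFlows]
  rw [← e.forall_congr_right, Sum.forall, and_comm]
  simp [completeFlow]

end FreeEdges

/-! ### The volume as an iterated edge integral -/

section Volume

open MvPolynomial

variable {r : ℕ}

theorem cons_mem_feasibleFlows (e : Fin r × Fin r) (L : List (Fin r × Fin r)) (b : Fin r → ℝ)
    (s : ℝ) (x : Fin L.length → ℝ) :
    (Fin.cons s x : Fin (e :: L).length → ℝ) ∈ feasibleFlows (e :: L).get b ↔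
      0 ≤ s ∧ x ∈ feasibleFlows L.get (moveFlow e.1 e.2 b s) := by
  have h : netOutflow (e :: L).get (Fin.cons s x : Fin (e :: L).length → ℝ) =
      s • (Pi.single e.1 1 - Pi.single e.2 1) + netOutflow L.get x := by
    simp only [netOutflow, Fintype.linearCombination_apply]
    exact Fin.sum_univ_succ _
  have h2 : (∀ k, 0 ≤ (Fin.cons s x : Fin (e :: L).length → ℝ) k) ↔ 0 ≤ s ∧ ∀ k, 0 ≤ x k :=
    Fin.forall_fin_succ
  change (_ ∧ ∀ i, 0 ≤ b i - netOutflow (e :: L).get _ i) ↔ _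
  rw [h]
  refine (and_congr_left' h2).trans ?_
  rw [and_assoc]
  simp only [feasibleFlows, Set.mem_ofPred_eq, moveFlow, Pi.sub_apply, Pi.add_apply, sub_sub]

theorem volume_feasibleFlows_cons (e : Fin r × Fin r) (L : List (Fin r × Fin r))
    (b : Fin r → ℝ) :
    volume (feasibleFlows (e :: L).get b) =
      ∫⁻ s in Set.Ici (0 : ℝ), volume (feasibleFlows L.get (moveFlow e.1 e.2 b s)) := by
  have hmp := (volume_preserving_piFinSuccAbove (fun _ : Fin (L.length + 1) => ℝ) 0).symm
  have hm : MeasurableSet (feasibleFlows (e :: L).get b) :=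
    measurableSet_feasibleFlows _ _
  rw [← lintegral_indicator measurableSet_Ici]
  have h1 := hmp.measure_preimage_equiv (feasibleFlows (e :: L).get b)
  refine h1.symm.trans ?_
  rw [Measure.volume_eq_prod, Measure.prod_apply (hmp.measurable hm)]
  refine lintegral_congr fun s => ?_
  have h2 : ∀ x, x ∈ Prod.mk s ⁻¹' ((MeasurableEquiv.piFinSuccAbove
      (fun _ : Fin (L.length + 1) => ℝ) 0).symm ⁻¹' feasibleFlows (e :: L).get b) ↔
        0 ≤ s ∧ x ∈ feasibleFlows L.get (moveFlow e.1 e.2 b s) := by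
    intro x
    rw [← cons_mem_feasibleFlows]
    have h3 : Fin.insertNth (α := fun _ => ℝ) 0 s x = Fin.cons s x := Fin.insertNth_zero ..
    rw [← h3]
    rfl
  by_cases hs : 0 ≤ s
  · rw [Set.indicator_of_mem (Set.mem_Ici.2 hs)]
    congr 1
    ext x
    rw [h2]
    simp [hs]
  · rw [Set.indicator_of_notMem (by simpa using hs)]
    convert measure_empty (μ := volume)
    ext x
    rw [h2]
    simp [hs]

/-- Serves to bound the amount sent along an edge by what its source holds: later edges cannot
refill the source. -/
theorem netOutflow_nonneg_of_forall_ne (L : List (Fin r × Fin r)) (i : Fin r)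
    (hi : ∀ e ∈ L, e.2 ≠ i) (x : Fin L.length → ℝ) (hx : ∀ k, 0 ≤ x k) :
    0 ≤ netOutflow L.get x i := by
  rw [netOutflow, Fintype.linearCombination_apply, Finset.sum_apply]
  refine Finset.sum_nonneg fun k _ => ?_
  have := hi (L.get k) (L.get_mem k)
  rw [Pi.smul_apply, Pi.sub_apply, Pi.single_eq_of_ne this.symm, sub_zero, Pi.single_apply]
  split_ifs <;> simp [hx k]

theorem moveFlow_nonneg {i j : Fin r} (hij : i ≠ j) {b : Fin r → ℝ} (hb : ∀ k, 0 ≤ b k) {s : ℝ}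
    (hs : s ∈ Set.Icc 0 (b i)) (k : Fin r) : 0 ≤ moveFlow i j b s k := by
  have := hb k
  simp only [moveFlow, Pi.sub_apply, Pi.smul_apply, Pi.single_apply, smul_eq_mul]
  split_ifs with h1 h2 h2
  · exact absurd (h1.symm.trans h2) hij
  · subst h1
    linarith [hs.2]
  · linarith [hs.1]
  · linarith

/-- The volume of the feasible flows, for edges sorted such that no edge enters the source of an
earlier edge. -/
theorem volume_feasibleFlows (L : List (Fin r × Fin r))
    (hL : L.Pairwise fun e e' => e'.2 ≠ e.1) (hne : ∀ e ∈ L, e.1 ≠ e.2)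
    (b : Fin r → ℝ) (hb : ∀ i, 0 ≤ b i) :
    0 ≤ eval b (edgesOp L 1) ∧
      volume (feasibleFlows L.get b) = ENNReal.ofReal (eval b (edgesOp L 1)) := by
  induction L generalizing b with
  | nil =>
    have : feasibleFlows ([] : List (Fin r × Fin r)).get b = Set.univ := by
      ext x
      simp [feasibleFlows, netOutflow, Fintype.linearCombination_apply, hb]
    rw [this]
    simp [edgesOp, volume_pi]
  | cons e L ih =>
    rw [List.pairwise_cons] at hL
    have ih := ih hL.2 fun e' he' => hne e' (by simp [he'])
    have he := hne e (by simp)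
    have hmove := fun s (hs : s ∈ Set.Icc 0 (b e.1)) => ih _ (moveFlow_nonneg he hb hs)
    have heval : eval b (edgesOp (e :: L) 1) =
        ∫ s in Set.Icc 0 (b e.1), eval (moveFlow e.1 e.2 b s) (edgesOp L 1) := by
      change eval b (edgeOp e (edgesOp L 1)) = _
      rw [eval_edgeOp, intervalIntegral.integral_of_le (hb e.1), integral_Icc_eq_integral_Ioc]
    rw [heval]
    refine ⟨setIntegral_nonneg measurableSet_Icc fun s hs => (hmove s hs).1, ?_⟩
    rw [ofReal_integral_eq_lintegral_ofReal
      ((continuous_eval_moveFlow _ _ _ _).integrableOn_Icc)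
      (ae_restrict_of_forall_mem measurableSet_Icc fun s hs => (hmove s hs).1),
      volume_feasibleFlows_cons, ← lintegral_indicator measurableSet_Ici,
      ← lintegral_indicator measurableSet_Icc]
    refine lintegral_congr fun s => ?_
    by_cases hs : s ∈ Set.Icc 0 (b e.1)
    · rw [Set.indicator_of_mem (Set.mem_Ici.2 hs.1), Set.indicator_of_mem hs, (hmove s hs).2]
    · rw [Set.indicator_of_notMem hs]
      by_cases hs0 : 0 ≤ s
      · rw [Set.indicator_of_mem (Set.mem_Ici.2 hs0)]
        -- Here s > b_i: the source is left with a negative amount that no later edge can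
        -- compensate, so no flow is feasible.
        convert measure_empty (μ := volume)
        refine Set.eq_empty_of_forall_notMem fun x hx => ?_
        have h1 := netOutflow_nonneg_of_forall_ne L e.1 hL.1 x hx.1
        have h2 := hx.2 e.1
        have h3 : moveFlow e.1 e.2 b s e.1 = b e.1 - s := by simp [moveFlow, he]
        rw [h3] at h2
        exact hs ⟨hs0, by linarith⟩
      · rw [Set.indicator_of_notMem (by simpa using hs0)]

theorem nonneg_of_mem_closure_niceChamber {a : flowSpace r} (ha : a ∈ closure (niceChamber r))
    (i : Fin r) : 0 ≤ (coordEquiv r).symm a i := by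
  have hc : IsClosed {a : flowSpace r | 0 ≤ a.1 i.castSucc} :=
    isClosed_le continuous_const ((continuous_apply _).comp continuous_subtype_val)
  exact closure_minimal (fun a ha => (ha.2 i).le) hc ha

/-- The labelling `t` splits the index set into the r edges to the sink, found by `f`, and the free
edges `L`, found by `g`; this bijection is the input of the measure reduction. -/
theorem isVolumePolynomial_edgesOp {ι : Type*} [Fintype ι] {Φ : ι → flowSpace r}
    (t : ι → Fin (r + 1) × Fin (r + 1)) (ht : Function.Injective t)
    (hΦ : ∀ k, Φ k = root (t k).1 (t k).2) (L : List (Fin r × Fin r)) (hnd : L.Nodup)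
    (hL : L.Pairwise fun e e' => e'.2 ≠ e.1) (hne : ∀ e ∈ L, e.1 ≠ e.2)
    (hlast : ∀ i : Fin r, (i.castSucc, Fin.last r) ∈ Set.range t)
    (hmem : ∀ i j : Fin r, (i.castSucc, j.castSucc) ∈ Set.range t ↔ (i, j) ∈ L)
    (hout : ∀ j, (Fin.last r, j) ∉ Set.range t) :
    IsVolumePolynomial Φ (edgesOp L 1) := by
  choose f hf using hlast
  have hg : ∀ k : Fin L.length, ∃ m, t m = ((L.get k).1.castSucc, (L.get k).2.castSucc) :=
    fun k => (hmem _ _).2 (L.get_mem k)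
  choose g hg using hg
  have hbij : Function.Bijective (Sum.elim f g) := by
    constructor
    · rw [Sum.elim_injective]
      refine ⟨fun i j h => ?_, fun k m h => ?_, fun i k h => ?_⟩
      · have := congrArg t h
        rw [hf, hf] at this
        simpa using this
      · have := congrArg t h
        rw [hg, hg] at this
        simp only [Prod.mk.injEq, Fin.castSucc_inj] at this
        exact List.nodup_iff_injective_get.1 hnd (Prod.ext this.1 this.2)
      · have := congrArg t h
        rw [hf, hg] at this
        exact (Fin.castSucc_lt_last _).ne' (Prod.ext_iff.1 this).2
    · intro m
      have hm : t m ∈ Set.range t := ⟨m, rfl⟩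
      rcases h : t m with ⟨i, j⟩
      rw [h] at hm
      induction i using Fin.lastCases with
      | last => exact absurd hm (hout j)
      | cast i =>
        induction j using Fin.lastCases with
        | last => exact ⟨.inl i, ht ((hf i).trans h.symm)⟩
        | cast j =>
          obtain ⟨k, hk⟩ := List.get_of_mem ((hmem i j).1 hm)
          exact ⟨.inr k, ht ((hg k).trans (by rw [hk, h]))⟩
  intro a ha
  have hvol := volume_feasibleFlows L hL hne _ (nonneg_of_mem_closure_niceChamber ha)
  rw [polytopeVolume_eq_volume_feasibleFlows (e := Equiv.ofBijective _ hbij) (E := L.get)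
    (fun i => by simp [hΦ, hf]) (fun k => by simp [hΦ, hg]), hvol.2]
  exact ⟨ENNReal.ofReal_ne_top, ENNReal.toReal_ofReal hvol.1⟩

end Volume

/-! ### Lexicographic order of the edges -/

section SortedEdges

variable {σ : Type*} [LinearOrder σ]

theorem mem_edgeList_iff {p q : σ} {l : List σ} (hl : (l ++ [p, q]).Pairwise (· < ·))
    (e : σ × σ) : e ∈ edgeList p q l ↔ e.1 ∈ l ∧ e.2 ∈ l ++ [p, q] ∧ e.1 < e.2 := by
  induction l with
  | nil => simp [edgeList]
  | cons i l ih =>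
    rw [List.cons_append, List.pairwise_cons] at hl
    obtain ⟨x, y⟩ := e
    rw [edgeList, List.mem_append, ih hl.2, List.mem_map, List.cons_append, List.mem_cons,
      List.mem_cons]
    dsimp only
    constructor
    · rintro (⟨j, hj, h⟩ | ⟨hx, hy, hxy⟩)
      · obtain ⟨rfl, rfl⟩ := Prod.mk.injEq .. ▸ h
        exact ⟨.inl rfl, .inr hj, hl.1 j hj⟩
      · exact ⟨.inr hx, .inr hy, hxy⟩
    · rintro ⟨rfl | hx, rfl | hy, hxy⟩
      · exact absurd hxy (lt_irrefl _)
      · exact .inl ⟨y, hy, rfl⟩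
      · exact absurd hxy (hl.1 x (List.mem_append_left _ hx)).not_gt
      · exact .inr ⟨hx, hy, hxy⟩

theorem pairwise_edgeList {p q : σ} {l : List σ} (hl : (l ++ [p, q]).Pairwise (· < ·)) :
    (edgeList p q l ++ [(p, q)]).Pairwise
      fun e e' => e.1 < e'.1 ∨ e.1 = e'.1 ∧ e.2 < e'.2 := by
  induction l with
  | nil => simp [edgeList]
  | cons i l ih =>
    rw [List.cons_append, List.pairwise_cons] at hl
    rw [edgeList, List.append_assoc, List.pairwise_append]
    refine ⟨?_, ih hl.2, ?_⟩
    · rw [List.pairwise_map]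
      exact hl.2.imp fun h => .inr ⟨rfl, h⟩
    · intro e he e' he'
      obtain ⟨j, -, rfl⟩ := List.mem_map.1 he
      rw [List.mem_append] at he'
      rcases he' with he' | he'
      · exact .inl (hl.1 _ (List.mem_append_left _ (fst_mem_of_mem_edgeList he')))
      · rw [List.mem_singleton.1 he']
        exact .inl (hl.1 p (by simp))

end SortedEdges

/-! ### The positive roots of type A and the two volume polynomials -/

open MvPolynomial

/-- The vertices `0, …, n - 1`, i.e. all but the last three of `0, …, n + 2`, in increasing order. -/
def initialVertices (n : ℕ) : List (Fin (n + 2)) :=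
  (List.finRange n).map (Fin.castAdd 2)

theorem mem_initialVertices {n : ℕ} {i : Fin (n + 2)} : i ∈ initialVertices n ↔ i.val < n := by
  rw [initialVertices, List.mem_map]
  constructor
  · rintro ⟨j, -, rfl⟩
    exact j.2
  · intro h
    exact ⟨⟨i, h⟩, List.mem_finRange _, rfl⟩

/-- The source of the edge which is removed. -/
abbrev removedSource (n : ℕ) : Fin (n + 2) := ⟨n, by omega⟩

/-- The target of the edge which is removed. -/
abbrev removedTarget (n : ℕ) : Fin (n + 2) := ⟨n + 1, by omega⟩

theorem pairwise_initialVertices (n : ℕ) :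
    (initialVertices n ++ [removedSource n, removedTarget n]).Pairwise (· < ·) := by
  rw [List.pairwise_append]
  refine ⟨?_, by simp, fun i hi j hj => ?_⟩
  · rw [initialVertices, List.pairwise_map]
    exact (List.pairwise_lt_finRange n).imp fun h => h
  · have := mem_initialVertices.1 hi
    simp only [List.mem_cons, List.not_mem_nil, or_false] at hj
    rcases hj with rfl | rfl <;> rw [Fin.lt_def] <;> dsimp only <;> omega

/-- The edges `i < j` with `j` not the last vertex, except the edge `(n, n + 1)`. -/
abbrev initialEdges (n : ℕ) : List (Fin (n + 2) × Fin (n + 2)) :=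
  edgeList (removedSource n) (removedTarget n) (initialVertices n)

theorem mem_initialEdges {n : ℕ} {i j : Fin (n + 2)} :
    (i, j) ∈ initialEdges n ↔ i.val < n ∧ i < j := by
  rw [mem_edgeList_iff (pairwise_initialVertices n), mem_initialVertices]
  refine and_congr_right fun _ => and_iff_right ?_
  dsimp only
  simp only [List.mem_append, mem_initialVertices, List.mem_cons, List.not_mem_nil, or_false,
    Fin.ext_iff]
  omega

theorem length_initialEdges (n : ℕ) :
    (initialEdges n).length + 1 = (n + 2) * (n + 2 - 1) / 2 := by
  have h := length_edgeList (removedSource n) (removedTarget n) (initialVertices n)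
  have hlen : (initialVertices n).length = n := by simp [initialVertices]
  rw [hlen] at h
  change _ = (n + 2) * (n + 1) / 2
  rw [← h]
  simp

theorem pairwise_allEdges (n : ℕ) :
    (initialEdges n ++ [(removedSource n, removedTarget n)]).Pairwise
      fun e e' => e.1 < e'.1 ∨ e.1 = e'.1 ∧ e.2 < e'.2 :=
  pairwise_edgeList (pairwise_initialVertices n)

/-- Strict lexicographic order excludes repetitions, and the target of a later edge exceeds its own
source, which is at least any earlier source. -/
theorem isVolumePolynomial_of_sorted {r : ℕ} {ι : Type*} [Fintype ι] {Φ : ι → flowSpace r}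
    (t : ι → Fin (r + 1) × Fin (r + 1)) (ht : Function.Injective t)
    (hΦ : ∀ k, Φ k = root (t k).1 (t k).2) (L : List (Fin r × Fin r))
    (hL : L.Pairwise fun e e' => e.1 < e'.1 ∨ e.1 = e'.1 ∧ e.2 < e'.2)
    (hlt : ∀ e ∈ L, e.1 < e.2)
    (hlast : ∀ i : Fin r, (i.castSucc, Fin.last r) ∈ Set.range t)
    (hmem : ∀ i j : Fin r, (i.castSucc, j.castSucc) ∈ Set.range t ↔ (i, j) ∈ L)
    (hout : ∀ j, (Fin.last r, j) ∉ Set.range t) :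
    IsVolumePolynomial Φ (edgesOp L 1) := by
  refine isVolumePolynomial_edgesOp t ht hΦ L ?_ ?_ (fun e he => (hlt e he).ne) hlast hmem hout
  · refine hL.imp fun {e e'} h => ?_
    rintro rfl
    simp at h
  · refine hL.imp_of_mem fun {e e'} _ he' h => ?_
    have h1 : e.1 ≤ e'.1 := h.elim le_of_lt fun h => h.1.le
    exact (h1.trans_lt (hlt e' he')).ne'

theorem mem_range_positiveRoots {r : ℕ} (x : Fin (r + 1) × Fin (r + 1)) :
    x ∈ Set.range (fun k : RootIndex r => k.1) ↔ x.1 < x.2 := by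
  simp

theorem isVolumePolynomial_positiveRoots (n : ℕ) :
    IsVolumePolynomial (positiveRoots (n + 2))
      (edgesOp (initialEdges n ++ [(removedSource n, removedTarget n)]) 1) := by
  have hmem : ∀ i j : Fin (n + 2),
      (i, j) ∈ initialEdges n ++ [(removedSource n, removedTarget n)] ↔ i < j := by
    intro i j
    rw [List.mem_append, mem_initialEdges]
    simp only [List.mem_singleton, Prod.mk.injEq, Fin.ext_iff, Fin.lt_def]
    omega
  have hΦ : ∀ k : RootIndex (n + 2), positiveRoots (n + 2) k = root k.1.1 k.1.2 := fun _ => rfl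
  refine isVolumePolynomial_of_sorted (fun k : RootIndex (n + 2) => k.1) Subtype.val_injective
    hΦ _ (pairwise_allEdges n) (fun e he => (hmem e.1 e.2).1 he) (fun i => ?_) (fun i j => ?_)
    (fun j => ?_)
  · exact (mem_range_positiveRoots _).2 i.castSucc_lt_last
  · rw [mem_range_positiveRoots, hmem]
    exact Fin.castSucc_lt_castSucc_iff
  · rw [mem_range_positiveRoots]
    exact (Fin.le_last j).not_gt

theorem isVolumePolynomial_positiveRootsMinus (n : ℕ) :
    IsVolumePolynomial (positiveRootsMinus (n + 2) ⟨n, by omega⟩ ⟨n + 1, by omega⟩)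
      (edgesOp (initialEdges n) 1) := by
  have hrange : ∀ x : Fin (n + 2 + 1) × Fin (n + 2 + 1), x ∈ Set.range
      (Subtype.val ∘ (Subtype.val :
        {k : RootIndex (n + 2) // k.1 ≠ (⟨n, by omega⟩, ⟨n + 1, by omega⟩)} → _)) ↔
        x.1 < x.2 ∧ x ≠ (⟨n, by omega⟩, ⟨n + 1, by omega⟩) := by
    intro x
    constructor
    · rintro ⟨k, rfl⟩
      exact ⟨k.1.2, k.2⟩
    · rintro ⟨h1, h2⟩
      exact ⟨⟨⟨x, h1⟩, h2⟩, rfl⟩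
  have hΦ : ∀ k : {k : RootIndex (n + 2) // k.1 ≠ (⟨n, by omega⟩, ⟨n + 1, by omega⟩)},
      positiveRootsMinus (n + 2) ⟨n, by omega⟩ ⟨n + 1, by omega⟩ k = root k.1.1.1 k.1.1.2 :=
    fun _ => rfl
  refine isVolumePolynomial_of_sorted _
    (Subtype.val_injective.comp Subtype.val_injective) hΦ _
    ((pairwise_allEdges n).sublist (List.sublist_append_left _ _))
    (fun e he => (mem_initialEdges.1 he).2) (fun i => ?_) (fun i j => ?_) (fun j => ?_)
  · rw [hrange]
    refine ⟨i.castSucc_lt_last, fun h => ?_⟩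
    have := congrArg (fun x => x.2.val) h
    simp at this
  · rw [hrange, mem_initialEdges]
    simp only [Ne, Prod.mk.injEq, Fin.ext_iff, Fin.lt_def, Fin.val_castSucc]
    omega
  · rw [hrange]
    exact fun h => (Fin.le_last j).not_gt h.1

theorem schmidtBincerForm_eq (n : ℕ) (hr : 2 ≤ n + 2) :
    schmidtBincerForm (n + 2) hr =
      ∑ k ∈ (initialVertices n).toFinset, X k + 3 * X (removedSource n) := by
  rw [schmidtBincerForm]
  congr 2
  ext i
  simp [mem_initialVertices]

theorem isHomogeneous_schmidtBincerForm (r : ℕ) (hr : 2 ≤ r) :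
    (schmidtBincerForm r hr).IsHomogeneous 1 := by
  refine (IsHomogeneous.sum _ _ _ fun i _ => isHomogeneous_X _ _).add ?_
  exact (isHomogeneous_C _ (3 : ℝ)).mul (isHomogeneous_X _ _)

theorem setLastTwoZero_eq_self {n : ℕ} {w : MvPolynomial (Fin (n + 2)) ℝ}
    (hw : w ∈ supported ℝ {k | k ∈ initialVertices n}) : setLastTwoZero w = w := by
  conv_rhs => rw [← aeval_X_left_apply w]
  refine eval₂Hom_congr' rfl (fun k hk _ => ?_) rfl
  have : k.val < n := mem_initialVertices.1 (mem_supported.1 hw hk)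
  simp [this]

/-- The edges from vertex 0 are outermost and there are m + 2 of them: to the m other initial
vertices and to the two vertices of the removed edge. -/
theorem X_zero_pow_dvd_edgesOp_initialEdges (m : ℕ) :
    X 0 ^ (m + 2) ∣ edgesOp (initialEdges (m + 1)) 1 := by
  have h := pairwise_initialVertices (m + 1)
  have hl : initialVertices (m + 1) =
      0 :: (List.finRange m).map (Fin.castAdd 2 ∘ Fin.succ) := by
    rw [initialVertices, List.finRange_succ, List.map_cons, List.map_map]
    rfl
  rw [initialEdges]
  rw [hl] at h ⊢
  rw [List.cons_append, List.pairwise_cons] at h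
  rw [edgeList, edgesOp_append]
  refine dvd_trans (dvd_of_eq ?_) (X_pow_dvd_edgesOp 0 _ (fun h0 => (h.1 0 h0).ne rfl) _)
  simp

end FlowPolytope

end

open FlowPolytope MvPolynomial in
theorem mainTheorem5 (r : ℕ) (hr : 2 ≤ r) :
    ∃ v w : MvPolynomial (Fin r) ℝ,
      IsVolumePolynomial (positiveRoots r) v ∧
      IsVolumePolynomial
        (positiveRootsMinus r ⟨r - 2, by omega⟩ ⟨r - 1, by omega⟩) w ∧
      (⟨r - 1, by omega⟩ : Fin r) ∉ v.vars ∧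
      v.IsHomogeneous (r * (r - 1) / 2) ∧
      v.degreeOf ⟨r - 2, by omega⟩ ≤ 1 ∧
      (3 ≤ r → X ⟨0, by omega⟩ ^ (r - 1) * schmidtBincerForm r hr ∣ v) ∧
      3 * v = schmidtBincerForm r hr * setLastTwoZero w := by
  obtain ⟨n, rfl⟩ : ∃ n, r = n + 2 := ⟨r - 2, by omega⟩
  let p : Fin (n + 2) := ⟨n, by omega⟩
  let q : Fin (n + 2) := ⟨n + 1, by omega⟩
  set w : MvPolynomial (Fin (n + 2)) ℝ := edgesOp (initialEdges n) 1 with hw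
  set v : MvPolynomial (Fin (n + 2)) ℝ := edgesOp (initialEdges n ++ [(p, q)]) 1 with hv
  have hws : w ∈ supported ℝ {k | k ∈ initialVertices n} :=
    edgesOp_edgeList_one_mem_supported _ _ _
  have hvX : v = edgesOp (initialEdges n) (X p) := by
    rw [hv, edgesOp_append]
    exact congrArg _ (edgeOp_one p q)
  have hmain : 3 * v = schmidtBincerForm (n + 2) hr * w := by
    rw [schmidtBincerForm_eq, hvX]
    exact three_mul_edgesOp_edgeList ((pairwise_initialVertices n).imp fun h => h.ne)
  have hvw : v = C (1 / 3) * (schmidtBincerForm (n + 2) hr * w) := by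
    rw [← hmain, ← mul_assoc, show (3 : MvPolynomial (Fin (n + 2)) ℝ) = C 3 from rfl, ← C_mul]
    norm_num
  -- Thus X_p enters v only through the linear form, which has degree 1.
  have hdegw : w.degreeOf p = 0 := by
    rw [degreeOf_def, Multiset.count_eq_zero, ← Multiset.mem_toFinset, ← vars_def]
    exact fun h => (mem_initialVertices.1 (mem_supported.1 hws h)).ne rfl
  refine ⟨v, w, isVolumePolynomial_positiveRoots n, isVolumePolynomial_positiveRootsMinus n,
    ?_, ?_, ?_, ?_, ?_⟩
  · have : v ∈ supported ℝ {k | k ≠ q} := by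
      rw [hvw, schmidtBincerForm_eq]
      have hle : {k | k ∈ initialVertices n} ⊆ {k | k ≠ q} := by
        intro k hk h
        have := mem_initialVertices.1 hk
        simp [h, q] at this
      refine mul_mem (Subalgebra.algebraMap_mem _ _) (mul_mem (add_mem (sum_mem fun k hk => ?_)
        (mul_mem (ofNat_mem _ 3) ?_)) (supported_mono hle hws))
      · exact X_mem_supported.2 (hle (List.mem_toFinset.1 hk))
      · exact X_mem_supported.2 (by simp [q, Fin.ext_iff])
    exact fun h => mem_supported.1 this h rfl
  · have := isHomogeneous_edgesOp (initialEdges n ++ [(p, q)])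
      (isHomogeneous_one (Fin (n + 2)) ℝ)
    rwa [List.length_append, List.length_singleton, zero_add, length_initialEdges] at this
  · change v.degreeOf p ≤ 1
    rw [hvw]
    refine (degreeOf_C_mul_le _ _ _).trans ((degreeOf_mul_le _ _ _).trans ?_)
    rw [hdegw, add_zero]
    exact (degreeOf_le_totalDegree _ _).trans
      (isHomogeneous_schmidtBincerForm _ hr).totalDegree_le
  · intro h3
    obtain ⟨m, rfl⟩ : ∃ m, n = m + 1 := ⟨n - 1, by omega⟩
    rw [hvw, mul_comm (schmidtBincerForm _ hr) w]
    exact (mul_dvd_mul_right (X_zero_pow_dvd_edgesOp_initialEdges m) _).mul_left _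
  · rw [setLastTwoZero_eq_self hws, hmain]
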